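/- Let $\mathbf Z$ be the algebra $(\mathbb Z;\wedge,\vee,\to,\neg)$ in which $\wedge,\vee$ are minimum and maximum, $\neg a=-a$, and $a\to b=(-a)\vee b$ if $a\le b$ and $a\to b=(-a)\wedge b$ otherwise. The subalgebras $\mathbf Z_k$ of $\mathbf Z$ $(k\ge 1)$ have universes $\{a: -n\le a\le n\}$ if $k=2n+1$ and $\{a:-n\le a\le n\}\setminus\{0\}$ if $k=2n$. Let $\mathbf W_k$ be $\mathbf Z_k$ with an additional constant $\mathbf t$, where $\mathbf t=0$ if $k$ is odd and $\mathbf t=1$ if $k$ is even. Let $\mathbb{I},\mathbb{H},\mathbb{S},\mathbb{P}$ denote closure under isomorphic copies, homomorphic images, nonempty subalgebras and arbitrary direct products (including the empty product, the one-element algebra). Let $\mathcal{SM}$ be the class of Sugihara monoids: the algebras $(A;\wedge,\vee,\to,\neg,\mathbf t)$ whose reduct without $\mathbf t$ lies in $\mathbb{HSP}(\mathbf Z)$ and in which $\mathbf t$ is an identity for the operation $a\cdot b=\neg(a\to\neg b)$. (i) For all $m\ge 1$, $\mathbb{ISP}(\mathbf W_{2m-1})=\mathbb{HSP}(\mathbf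 W_{2m-1})$; in particular this class is a variety (it is closed under $\mathbb H$, $\mathbb S$ and $\mathbb P$). (ii) For all $m\ge 2$, $\mathbb{ISP}(\mathbf W_{2m})\subsetneq\mathbb{HSP}(\mathbf W_{2m})$; and for all $m\ge 1$, $\mathbb{HSP}(\mathbf W_{2m})=\mathbb{ISP}(\mathbf W_{2m},\mathbf W_{2m-1})$. (iii) For all $k,l\ge 1$: - $\mathbb{ISP}(\mathbf W_k)\subseteq\mathbb{ISP}(\mathbf W_l)$ if and only if $k=1$, or $k\le l$ and $k,l$ have the same parity; - $\mathbb{HSP}(\mathbf W_k)\subseteq\mathbb{HSP}(\mathbf W_l)$ if and only if $k\le l$ and ($l$ is even whenever $k$ is even); - $\mathbb{ISP}(\mathbf W_k)\subsetneq\mathcal{SM}$ and $\mathbb{HSP}(\mathbf W_k)\subsetneq\mathcal{SM}$. In particular, $\mathbf W_{2m}\notin\mathbb{HSP}(\mathbf W_{2n-1})$ for all $m,n\ge1$, and $\mathbf W_k\notin\mathbb{HSP}(\mathbf W_l)$ whenever $1\le l<k$. -/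

import Mathlib

open FirstOrder CategoryTheory

universe w

namespace Sugihara

/-! ### Class operators for algebras of an arbitrary similarity type

Similarity types are (relation-free) first-order languages `L`; an algebra in the universe `w` is a
bundled `L`-structure, and a class of algebras is a set of those. -/

section ClassOperators

variable {L : FirstOrder.Language.{0, 0}}

/-- The direct product of a family of algebras, with pointwise operations. -/
def prodAlg {ι : Type w} (F : ι → Bundled.{w} L.Structure) : Bundled.{w} L.Structure :=
  ⟨∀ i, F i,
    { funMap := fun f x i => FirstOrder.Language.Structure.funMap f (fun j => x j i)
      RelMap := fun r x => ∀ i, FirstOrder.Language.Structure.RelMap r (fun j => x j i) }⟩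

/-- `opI K`: isomorphic copies of members of `K`. -/
def opI (K : Set (Bundled.{w} L.Structure)) : Set (Bundled.{w} L.Structure) :=
  {A | ∃ B ∈ K, Nonempty (B ≃[L] A)}

/-- `opH K`: homomorphic images of members of `K`. -/
def opH (K : Set (Bundled.{w} L.Structure)) : Set (Bundled.{w} L.Structure) :=
  {A | ∃ B ∈ K, ∃ h : B →[L] A, Function.Surjective h}

/-- `opS K`: (nonempty) subalgebras of members of `K`. -/
def opS (K : Set (Bundled.{w} L.Structure)) : Set (Bundled.{w} L.Structure) :=
  {A | ∃ B ∈ K, ∃ s : L.Substructure B, (s : Set B).Nonempty ∧ A = Bundled.of (c := L.Structure) s}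

/-- `opP K`: direct products of families of members of `K`, including the product of the empty
family, which is the one-element algebra. -/
def opP (K : Set (Bundled.{w} L.Structure)) : Set (Bundled.{w} L.Structure) :=
  {A | ∃ (ι : Type w) (F : ι → Bundled.{w} L.Structure), (∀ i, F i ∈ K) ∧ A = prodAlg F}

def ISP (K : Set (Bundled.{w} L.Structure)) : Set (Bundled.{w} L.Structure) := opI (opS (opP K))

def HSP (K : Set (Bundled.{w} L.Structure)) : Set (Bundled.{w} L.Structure) := opH (opS (opP K))

/-- A variety: a class of algebras closed under homomorphic images, subalgebras and products. -/
def IsVariety (K : Set (Bundled.{w} L.Structure)) : Prop :=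
  opH K ⊆ K ∧ opS K ⊆ K ∧ opP K ⊆ K

end ClassOperators

/-! ### The two similarity types -/

/-- Operation symbols `∧, ∨, →, ¬` of Sugihara algebras. -/
inductive SAOp : ℕ → Type
  | inf : SAOp 2
  | sup : SAOp 2
  | imp : SAOp 2
  | neg : SAOp 1

/-- Operation symbols of Sugihara monoids: those of Sugihara algebras and the constant `t`. -/
inductive SMOp : ℕ → Type
  | ofSA {n : ℕ} (f : SAOp n) : SMOp n
  | t : SMOp 0

def langSA : FirstOrder.Language.{0, 0} := ⟨SAOp, fun _ => Empty⟩

def langSM : FirstOrder.Language.{0, 0} := ⟨SMOp, fun _ => Empty⟩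

/-- The inclusion of the language of Sugihara algebras in that of Sugihara monoids. -/
def inclSA : langSA →ᴸ langSM where
  onFunction := fun _ f => SMOp.ofSA f
  onRelation := fun _ r => r

/-! ### The algebra `Z` of the integers and its subalgebras `Z_k` -/

/-- The implication of the Sugihara algebra of the integers. -/
def impZ (a b : ℤ) : ℤ := if a ≤ b then (-a) ⊔ b else (-a) ⊓ b

/-- The Sugihara algebra `Z` of the integers. -/
instance structZ : langSA.Structure ℤ where
  funMap := fun {n} (f : SAOp n) =>
    match n, f with
    | _, SAOp.inf => fun x => x 0 ⊓ x 1
    | _, SAOp.sup => fun x => x 0 ⊔ x 1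
    | _, SAOp.imp => fun x => impZ (x 0) (x 1)
    | _, SAOp.neg => fun x => -(x 0)
  RelMap := fun r _ => Empty.elim r

/-- The subalgebra `Z_k` of `Z`: for `k = 2n + 1` its universe is `{a | -n ≤ a ≤ n}`, and for
`k = 2n` it is `{a | -n ≤ a ≤ n} \ {0}`. -/
def Zsub (k : ℕ) : langSA.Substructure ℤ where
  carrier := {a : ℤ | -((k / 2 : ℕ) : ℤ) ≤ a ∧ a ≤ ((k / 2 : ℕ) : ℤ) ∧ (Even k → a ≠ 0)}
  fun_mem := by
    intro n f
    change SAOp n at f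
    intro x hx
    simp only [Set.mem_ofPred_eq] at hx
    generalize ((k / 2 : ℕ) : ℤ) = q at hx ⊢
    cases f with
    | inf =>
      have h0 := hx 0
      have h1 := hx 1
      change _ ≤ x 0 ⊓ x 1 ∧ x 0 ⊓ x 1 ≤ _ ∧ (_ → x 0 ⊓ x 1 ≠ 0)
      rcases min_choice (x 0) (x 1) with h | h <;> rw [h] <;> assumption
    | sup =>
      have h0 := hx 0
      have h1 := hx 1
      change _ ≤ x 0 ⊔ x 1 ∧ x 0 ⊔ x 1 ≤ _ ∧ (_ → x 0 ⊔ x 1 ≠ 0)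
      rcases max_choice (x 0) (x 1) with h | h <;> rw [h] <;> assumption
    | imp =>
      have h0 := hx 0
      have h1 := hx 1
      change _ ≤ impZ (x 0) (x 1) ∧ impZ (x 0) (x 1) ≤ _ ∧ (_ → impZ (x 0) (x 1) ≠ 0)
      have h : impZ (x 0) (x 1) = -(x 0) ∨ impZ (x 0) (x 1) = x 1 := by
        unfold impZ
        split
        · exact max_choice _ _
        · exact min_choice _ _
      rcases h with h | h
      · rw [h]
        exact ⟨by omega, by omega, fun hk => neg_ne_zero.mpr (h0.2.2 hk)⟩
      · rw [h]; exact h1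
    | neg =>
      have h0 := hx 0
      change _ ≤ -(x 0) ∧ -(x 0) ≤ _ ∧ (_ → -(x 0) ≠ 0)
      exact ⟨by omega, by omega, fun hk => neg_ne_zero.mpr (h0.2.2 hk)⟩

/-! ### The Sugihara monoids `W_k` -/

/-- The value of `t` in `W_k`: `0` if `k` is odd and `1` if `k` is even. -/
def tZ (k : ℕ) : ℤ := if Even k then 1 else 0

theorem tZ_mem (k : ℕ) (hk : 1 ≤ k) : tZ k ∈ Zsub k := by
  change -((k / 2 : ℕ) : ℤ) ≤ tZ k ∧ tZ k ≤ ((k / 2 : ℕ) : ℤ) ∧ (Even k → tZ k ≠ 0)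
  unfold tZ
  split
  · rename_i h
    obtain ⟨r, rfl⟩ := h
    refine ⟨?_, ?_, fun _ => one_ne_zero⟩ <;> omega
  · rename_i h
    refine ⟨?_, ?_, fun h' => absurd h' h⟩ <;> omega

/-- The expansion of `Z_k` by the constant `t`. -/
@[reducible]
def structW (k : ℕ) (hk : 1 ≤ k) : langSM.Structure (Zsub k) where
  funMap := fun {n} (f : SMOp n) =>
    match n, f with
    | _, SMOp.ofSA g => fun x => FirstOrder.Language.Structure.funMap (L := langSA) g x
    | _, SMOp.t => fun _ => ⟨tZ k, tZ_mem k hk⟩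
  RelMap := fun r _ => Empty.elim r

/-- The Sugihara monoid `W_k` (`k ≥ 1`), as an algebra in an arbitrary universe. -/
def W (k : ℕ) (hk : 1 ≤ k) : Bundled.{w} langSM.Structure :=
  letI := structW k hk
  (Equiv.ulift.{w} (α := Zsub k)).symm.bundledInduced langSM

/-! ### The classes `SA` and `SM` -/

/-- The algebra `Z` of the integers, in an arbitrary universe. -/
def Z : Bundled.{w} langSA.Structure :=
  (Equiv.ulift.{w} (α := ℤ)).symm.bundledInduced langSA

/-- The variety of Sugihara algebras. -/
def SA : Set (Bundled.{w} langSA.Structure) := HSP {Z}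

/-- The reduct of an algebra of the type of Sugihara monoids obtained by forgetting `t`. -/
def reductSA (A : Bundled.{w} langSM.Structure) : Bundled.{w} langSA.Structure :=
  ⟨A, inclSA.reduct A⟩

section Ops

variable (A : Bundled.{w} langSM.Structure)

def imp (a b : A) : A := FirstOrder.Language.Structure.funMap (L := langSM) (SMOp.ofSA SAOp.imp) ![a, b]

def neg (a : A) : A := FirstOrder.Language.Structure.funMap (L := langSM) (SMOp.ofSA SAOp.neg) ![a]

def tt : A := FirstOrder.Language.Structure.funMap (L := langSM) SMOp.t ![]

/-- The derived fusion operation `a · b = ¬(a → ¬b)`. -/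
def fusion (a b : A) : A := neg A (imp A a (neg A b))

end Ops

/-- The class of Sugihara monoids. -/
def SM : Set (Bundled.{w} langSM.Structure) :=
  {A | reductSA A ∈ SA ∧ ∀ a : A, fusion A (tt A) a = a ∧ fusion A a (tt A) = a}

end Sugihara

/-! For nonempty algebras, membership in `ISP K` means that homomorphisms into members of `K`
separate points. So everything reduces to the homomorphisms into the finite chains `W k`, handled as
integer-valued functions (`IsVal`).

The core is `exists_valuation_factoring`. Let valuations in `W k` separate the points of `B`, and
let `h : B → A` be a homomorphism. The kernel of `h` is governed by the filter of all `x` with `h (x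
∧ t) = t`. If `h a ≠ h b`, then `a → b` or `b → a` is outside this filter, hence outside some prime
filter containing it. As `W k` is finite, an ultrafilter limit of valuations is again a valuation
`e`, and it can be chosen below `t` off the prime filter. Let `s` be the least value of `e` on the
prime filter. If `s = 1`, then `e` itself factors through `h`; otherwise `s ≤ 0`, and `e` followed
by the collapse of `[s, -s]` to `0` does. For even `k` the collapse sends `t` to `0` and lands in `W
(k - 1)`; for odd `k` it stays in `W k`. This yields (i) and one half of the equality in (ii).

The inclusions come from embeddings between chains of equal parity and from collapsing an even chain
onto a shorter odd one. The obstructions are the fixed point `0` of negation in odd chains, the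
equation `t = ¬t` there, and the fact that a valuation separating `1` from `-t` is strictly
increasing on positive elements (`le_of_isVal`). -/

namespace Sugihara

/-! ### Generalities on the class operators -/

section ClassOperators

variable {L : FirstOrder.Language.{0, 0}}

/-- A family of homomorphisms, as a homomorphism into the product. -/
def homToProd {ι : Type w} {A : Bundled.{w} L.Structure} {F : ι → Bundled.{w} L.Structure}
    (f : ∀ i, A →[L] F i) : A →[L] prodAlg F where
  toFun a i := f i a
  map_fun' g x := funext fun i => (f i).map_fun g x
  map_rel' r x hx i := (f i).map_rel r x hx

/-- The projections of a direct product. -/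
def projProd {ι : Type w} (F : ι → Bundled.{w} L.Structure) (i : ι) : prodAlg F →[L] F i where
  toFun a := a i
  map_fun' _ _ := rfl
  map_rel' _ _ hx := hx i

/-- The homomorphism between products induced by homomorphisms of the factors. -/
def mapProd {ι : Type w} {F G : ι → Bundled.{w} L.Structure}
    (f : ∀ i, F i →[L] G i) : prodAlg F →[L] prodAlg G :=
  homToProd (A := prodAlg F) fun i => (f i).comp (projProd F i)

/-- Homomorphisms from `A` to members of `K` separate the points of `A`. -/
def SeparatedBy (K : Set (Bundled.{w} L.Structure)) (A : Bundled.{w} L.Structure) : Prop :=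
  ∀ a b : A, a ≠ b → ∃ B ∈ K, ∃ f : A →[L] B, f a ≠ f b

theorem separatedBy_of_mem_ISP {K : Set (Bundled.{w} L.Structure)} {A : Bundled.{w} L.Structure}
    (h : A ∈ ISP K) : SeparatedBy K A := by
  obtain ⟨_, ⟨_, ⟨ι, F, hF, rfl⟩, s, -, rfl⟩, ⟨e⟩⟩ := h
  intro a b hab
  have h1 : s.subtype (e.symm a) ≠ s.subtype (e.symm b) := fun h =>
    hab (e.symm.injective (Subtype.ext h))
  obtain ⟨i, hi⟩ := Function.ne_iff.1 h1
  exact ⟨F i, hF i, (projProd F i).comp (s.subtype.toHom.comp e.symm.toHom), hi⟩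

theorem nonempty_of_mem_ISP {K : Set (Bundled.{w} L.Structure)} {A : Bundled.{w} L.Structure}
    (h : A ∈ ISP K) : Nonempty A := by
  obtain ⟨_, ⟨_, -, s, ⟨x, hx⟩, rfl⟩, ⟨e⟩⟩ := h
  exact ⟨e ⟨x, hx⟩⟩

/-- One factor for each pair of distinct points makes the map into the product injective. Without
relation symbols, an injective homomorphism is an embedding. -/
theorem mem_ISP_of_separatedBy [L.IsAlgebraic] {K : Set (Bundled.{w} L.Structure)}
    {A : Bundled.{w} L.Structure} [Nonempty A] (h : SeparatedBy K A) : A ∈ ISP K := by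
  choose F hF f hf using h
  let ι : Type w := {p : A × A // p.1 ≠ p.2}
  let φ : A →[L] prodAlg (fun p : ι => F _ _ p.2) := homToProd fun p : ι => f _ _ p.2
  have hφ : Function.Injective φ := by
    intro a b hab
    by_contra hne
    exact hf a b hne (congrFun hab ⟨(a, b), hne⟩)
  let e := FirstOrder.Language.Embedding.ofInjective hφ
  exact ⟨_, ⟨_, ⟨ι, _, fun p => hF _ _ p.2, rfl⟩, e.toHom.range,
    ⟨e (Classical.arbitrary A), _, rfl⟩, rfl⟩, ⟨e.equivRange.symm⟩⟩

theorem subset_ISP [L.IsAlgebraic] {K : Set (Bundled.{w} L.Structure)}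
    {A : Bundled.{w} L.Structure} [Nonempty A] (hA : A ∈ K) : A ∈ ISP K :=
  mem_ISP_of_separatedBy fun _ _ hab => ⟨A, hA, FirstOrder.Language.Hom.id L A, hab⟩

theorem ISP_subset_ISP [L.IsAlgebraic] {K K' : Set (Bundled.{w} L.Structure)}
    (h : ∀ B ∈ K, SeparatedBy K' B) : ISP K ⊆ ISP K' := by
  intro A hA
  have := nonempty_of_mem_ISP hA
  refine mem_ISP_of_separatedBy fun a b hab => ?_
  obtain ⟨B, hB, f, hf⟩ := separatedBy_of_mem_ISP hA a b hab
  obtain ⟨C, hC, g, hg⟩ := h B hB _ _ hf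
  exact ⟨C, hC, g.comp f, hg⟩

theorem ISP_subset_HSP (K : Set (Bundled.{w} L.Structure)) : ISP K ⊆ HSP K := by
  rintro A ⟨B, hB, ⟨e⟩⟩
  exact ⟨B, hB, e.toHom, e.surjective⟩

theorem opH_trans {A B : Bundled.{w} L.Structure} {K : Set (Bundled.{w} L.Structure)}
    (hB : B ∈ opH K) (f : B →[L] A) (hf : Function.Surjective f) : A ∈ opH K := by
  obtain ⟨C, hC, g, hg⟩ := hB
  exact ⟨C, hC, f.comp g, hf.comp hg⟩

theorem opH_HSP_subset (K : Set (Bundled.{w} L.Structure)) : opH (HSP K) ⊆ HSP K := by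
  rintro A ⟨B, hB, f, hf⟩
  exact opH_trans hB f hf

theorem opS_ISP_subset [L.IsAlgebraic] (K : Set (Bundled.{w} L.Structure)) :
    opS (ISP K) ⊆ ISP K := by
  rintro _ ⟨B, hB, s, ⟨x, hx⟩, rfl⟩
  have : Nonempty (Bundled.of (c := L.Structure) s) := ⟨⟨x, hx⟩⟩
  refine mem_ISP_of_separatedBy fun a b hab => ?_
  obtain ⟨C, hC, f, hf⟩ := separatedBy_of_mem_ISP hB _ _ fun h => hab (Subtype.ext h)
  exact ⟨C, hC, f.comp s.subtype.toHom, hf⟩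

theorem opP_ISP_subset [L.IsAlgebraic] (K : Set (Bundled.{w} L.Structure)) :
    opP (ISP K) ⊆ ISP K := by
  rintro _ ⟨ι, F, hF, rfl⟩
  have : Nonempty (prodAlg F) := ⟨fun i => (nonempty_of_mem_ISP (hF i)).some⟩
  refine mem_ISP_of_separatedBy fun a b hab => ?_
  obtain ⟨i, hi⟩ := Function.ne_iff.1 hab
  obtain ⟨C, hC, f, hf⟩ := separatedBy_of_mem_ISP (hF i) _ _ hi
  exact ⟨C, hC, f.comp (projProd F i), hf⟩

theorem isVariety_ISP [L.IsAlgebraic] {K : Set (Bundled.{w} L.Structure)} (h : ISP K = HSP K) :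
    IsVariety (ISP K) :=
  ⟨by rw [h]; exact opH_HSP_subset K, opS_ISP_subset K, opP_ISP_subset K⟩

theorem opSP_subset_ISP (K : Set (Bundled.{w} L.Structure)) : opS (opP K) ⊆ ISP K :=
  fun A hA => ⟨A, hA, ⟨FirstOrder.Language.Equiv.refl L A⟩⟩

theorem HSP_subset_HSP {K K' : Set (Bundled.{w} L.Structure)} (h : ISP K ⊆ HSP K') :
    HSP K ⊆ HSP K' := by
  rintro A ⟨B, hB, f, hf⟩
  exact opH_trans (h (opSP_subset_ISP K hB)) f hf

/-- Subalgebras of products of homomorphic images are homomorphic images of subalgebras of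
products. -/
theorem ISP_subset_HSP_of_subset_opH {K K' : Set (Bundled.{w} L.Structure)} (h : K ⊆ opH K') :
    ISP K ⊆ HSP K' := by
  rintro A ⟨_, ⟨_, ⟨ι, F, hF, rfl⟩, s, ⟨x, hx⟩, rfl⟩, ⟨e⟩⟩
  choose G hG g hg using fun i => h (hF i)
  let φ : prodAlg G →[L] prodAlg F := mapProd g
  have hφ : Function.Surjective φ := fun y =>
    ⟨fun i => (hg i (y i)).choose, funext fun i => (hg i (y i)).choose_spec⟩
  obtain ⟨x', rfl⟩ := hφ x
  -- The preimage of `s` under the surjection of products maps onto `s`.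
  refine ⟨_, ⟨_, ⟨ι, G, hG, rfl⟩, s.comap φ, ⟨x', hx⟩, rfl⟩,
    e.toHom.comp ⟨fun y => ⟨φ y.1, y.2⟩, fun f y => Subtype.ext (φ.map_fun f _),
      fun r y hy => φ.map_rel r _ hy⟩, e.surjective.comp ?_⟩
  rintro ⟨y, hy⟩
  obtain ⟨y', rfl⟩ := hφ y
  exact ⟨⟨y', hy⟩, rfl⟩

end ClassOperators

instance : langSM.IsAlgebraic := fun _ => inferInstanceAs (IsEmpty Empty)

instance : langSA.IsAlgebraic := fun _ => inferInstanceAs (IsEmpty Empty)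

/-! ### Valuations in the algebras `W_k` -/

section Valuations

variable (A : Bundled.{w} langSM.Structure)

/-- The meet operation. -/
def inf (a b : A) : A := FirstOrder.Language.Structure.funMap (L := langSM) (SMOp.ofSA SAOp.inf) ![a, b]

/-- The join operation. -/
def sup (a b : A) : A := FirstOrder.Language.Structure.funMap (L := langSM) (SMOp.ofSA SAOp.sup) ![a, b]

instance : Nonempty A := ⟨tt A⟩

variable {A}

/-- An integer-valued function that is a homomorphism to `W_k`. -/
structure IsVal (k : ℕ) (f : A → ℤ) : Prop where
  mem : ∀ a, f a ∈ Zsub k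
  map_inf : ∀ a b, f (inf A a b) = f a ⊓ f b
  map_sup : ∀ a b, f (sup A a b) = f a ⊔ f b
  map_imp : ∀ a b, f (imp A a b) = impZ (f a) (f b)
  map_neg : ∀ a, f (neg A a) = -f a
  map_tt : f (tt A) = tZ k

theorem IsVal.map_fusion {k : ℕ} {f : A → ℤ} (hf : IsVal k f) (a b : A) :
    f (fusion A a b) = -impZ (f a) (-f b) := by
  rw [fusion, hf.map_neg, hf.map_imp, hf.map_neg]

variable {B : Bundled.{w} langSM.Structure}

theorem hom_map₂ (f : A →[langSM] B) (o : SMOp 2) (a b : A) :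
    f (FirstOrder.Language.Structure.funMap (L := langSM) o ![a, b]) =
      FirstOrder.Language.Structure.funMap (L := langSM) o ![f a, f b] := by
  refine (f.map_fun (o : langSM.Functions 2) _).trans (congrArg _ ?_)
  funext i
  fin_cases i <;> rfl

theorem hom_inf (f : A →[langSM] B) (a b : A) : f (inf A a b) = inf B (f a) (f b) :=
  hom_map₂ f _ a b

theorem hom_sup (f : A →[langSM] B) (a b : A) : f (sup A a b) = sup B (f a) (f b) :=
  hom_map₂ f _ a b

theorem hom_imp (f : A →[langSM] B) (a b : A) : f (imp A a b) = imp B (f a) (f b) :=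
  hom_map₂ f _ a b

theorem hom_neg (f : A →[langSM] B) (a : A) : f (neg A a) = neg B (f a) := by
  refine (f.map_fun (SMOp.ofSA SAOp.neg : langSM.Functions 1) _).trans (congrArg _ ?_)
  funext i
  fin_cases i; rfl

theorem hom_tt (f : A →[langSM] B) : f (tt A) = tt B := by
  refine (f.map_fun (SMOp.t : langSM.Functions 0) _).trans (congrArg _ ?_)
  funext i
  exact i.elim0

theorem hom_fusion (f : A →[langSM] B) (a b : A) :
    f (fusion A a b) = fusion B (f a) (f b) := by
  rw [fusion, hom_neg, hom_imp, hom_neg, fusion]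

theorem IsVal.comp_hom {k : ℕ} {v : B → ℤ} (hv : IsVal k v) (f : A →[langSM] B) :
    IsVal k (v ∘ f) where
  mem a := hv.mem _
  map_inf a b := by simp only [Function.comp, hom_inf, hv.map_inf]
  map_sup a b := by simp only [Function.comp, hom_sup, hv.map_sup]
  map_imp a b := by simp only [Function.comp, hom_imp, hv.map_imp]
  map_neg a := by simp only [Function.comp, hom_neg, hv.map_neg]
  map_tt := by simp only [Function.comp, hom_tt, hv.map_tt]

/-- The underlying integer of an element of `W_k`. -/
def valW {k : ℕ} (hk : 1 ≤ k) (a : W.{w} k hk) : ℤ := (ULift.down (α := Zsub k) a).1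

/-- An integer as an element of `W_k`. -/
def mkW {k : ℕ} (hk : 1 ≤ k) (a : ℤ) (ha : a ∈ Zsub k) : W.{w} k hk :=
  ULift.up (α := Zsub k) ⟨a, ha⟩

theorem valW_mkW {k : ℕ} (hk : 1 ≤ k) (a : ℤ) (ha : a ∈ Zsub k) : valW hk (mkW.{w} hk a ha) = a :=
  rfl

theorem valW_injective {k : ℕ} (hk : 1 ≤ k) : Function.Injective (valW.{w} hk) := fun _ _ h =>
  ULift.down_injective (Subtype.ext h)

theorem isVal_valW {k : ℕ} (hk : 1 ≤ k) : IsVal k (valW.{w} hk) where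
  mem a := (ULift.down (α := Zsub k) a).2
  map_inf _ _ := rfl
  map_sup _ _ := rfl
  map_imp _ _ := rfl
  map_neg _ := rfl
  map_tt := rfl

theorem vec_two_eta {α : Type*} (x : Fin 2 → α) : x = ![x 0, x 1] := by
  funext i
  fin_cases i <;> rfl

theorem vec_one_eta {α : Type*} (x : Fin 1 → α) : x = ![x 0] := by
  funext i
  fin_cases i; rfl

/-- A valuation as a homomorphism to `W_k`. -/
def IsVal.toHom {k : ℕ} (hk : 1 ≤ k) {f : A → ℤ} (hf : IsVal k f) : A →[langSM] W.{w} k hk where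
  toFun a := mkW hk (f a) (hf.mem a)
  map_fun' := by
    intro n (o : SMOp n) x
    apply valW_injective hk
    cases o with
    | ofSA o =>
      cases o with
      | inf => rw [vec_two_eta x]; exact hf.map_inf _ _
      | sup => rw [vec_two_eta x]; exact hf.map_sup _ _
      | imp => rw [vec_two_eta x]; exact hf.map_imp _ _
      | neg => rw [vec_one_eta x]; exact hf.map_neg _
    | t => rw [Subsingleton.elim x ![] ]; exact hf.map_tt
  map_rel' r := Empty.elim r

/-- A valuation as a homomorphism of Sugihara algebras to `Z`. -/
def IsVal.toHomZ {k : ℕ} {f : A → ℤ} (hf : IsVal k f) : reductSA A →[langSA] Z.{w} where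
  toFun a := ULift.up (f a)
  map_fun' := by
    intro n (o : SAOp n) x
    refine ULift.down_injective ?_
    cases o with
    | inf => rw [vec_two_eta x]; exact hf.map_inf _ _
    | sup => rw [vec_two_eta x]; exact hf.map_sup _ _
    | imp => rw [vec_two_eta x]; exact hf.map_imp _ _
    | neg => rw [vec_one_eta x]; exact hf.map_neg _
  map_rel' r := Empty.elim r

/-- A homomorphism as a homomorphism of the reducts. -/
def reductHom (f : A →[langSM] B) : reductSA A →[langSA] reductSA B where
  toFun := f
  map_fun' {_} o x := f.map_fun (inclSA.onFunction o) x
  map_rel' r := Empty.elim r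

/-- Valuations in `W_k` separate the points of `A`. -/
def SeparatedByVal (k : ℕ) (A : Bundled.{w} langSM.Structure) : Prop :=
  ∀ a b : A, (∀ f : A → ℤ, IsVal k f → f a = f b) → a = b

theorem exists_isVal_of_hom {k : ℕ} {hk : 1 ≤ k} {a b : A} (f : A →[langSM] W.{w} k hk)
    (hf : f a ≠ f b) : ∃ v : A → ℤ, IsVal k v ∧ v a ≠ v b :=
  ⟨_, (isVal_valW hk).comp_hom f, fun h => hf (valW_injective hk h)⟩

theorem separatedByVal_of_mem_ISP {k : ℕ} {hk : 1 ≤ k} (h : A ∈ ISP {W.{w} k hk}) :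
    SeparatedByVal k A := by
  intro a b hab
  by_contra hne
  obtain ⟨_, rfl, f, hf⟩ := separatedBy_of_mem_ISP h a b hne
  obtain ⟨v, hv, hvne⟩ := exists_isVal_of_hom f hf
  exact hvne (hab v hv)

theorem IsVal.toHom_ne {k : ℕ} (hk : 1 ≤ k) {f : A → ℤ} (hf : IsVal k f) {a b : A}
    (hab : f a ≠ f b) : hf.toHom hk a ≠ hf.toHom hk b := fun h =>
  hab (congrArg (valW hk) h)

end Valuations

/-! ### Arithmetic in `Z` -/

theorem mem_Zsub {k : ℕ} {a : ℤ} :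
    a ∈ Zsub k ↔ -((k / 2 : ℕ) : ℤ) ≤ a ∧ a ≤ ((k / 2 : ℕ) : ℤ) ∧ (Even k → a ≠ 0) :=
  Iff.rfl

theorem tZ_le_impZ {k : ℕ} {a b : ℤ} (ha : a ∈ Zsub k) (hb : b ∈ Zsub k) :
    tZ k ≤ impZ a b ↔ a ≤ b := by
  rw [mem_Zsub] at ha hb
  unfold tZ impZ
  by_cases hk : Even k
  · have h1 := ha.2.2 hk
    have h2 := hb.2.2 hk
    rw [if_pos hk]
    split_ifs <;> omega
  · rw [if_neg hk]
    split_ifs <;> omega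

theorem fusion_tZ {k : ℕ} {a : ℤ} (ha : a ∈ Zsub k) :
    -impZ a (-tZ k) = a ∧ -impZ (tZ k) (-a) = a := by
  rw [mem_Zsub] at ha
  unfold tZ impZ
  by_cases hk : Even k
  · have h1 := ha.2.2 hk
    rw [if_pos hk]
    constructor <;> split_ifs <;> omega
  · rw [if_neg hk]
    constructor <;> split_ifs <;> omega

/-- Modus ponens for fusion; the meet with `t` matches the filter used to describe kernels. -/
theorem fusion_imp_le {k : ℕ} {a b : ℤ} (ha : a ∈ Zsub k) (hb : b ∈ Zsub k) :
    -impZ a (-(impZ a b ⊓ tZ k)) ≤ b := by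
  rw [mem_Zsub] at ha hb
  unfold tZ impZ
  by_cases hk : Even k
  · have h1 := ha.2.2 hk
    have h2 := hb.2.2 hk
    rw [if_pos hk]
    split_ifs <;> omega
  · rw [if_neg hk]
    split_ifs <;> omega

/-- The endomorphism of `Z` collapsing the interval `[-q, q]` to `0`. -/
def collapse (q a : ℤ) : ℤ := a - max (-q) (min q a)

theorem impZ_collapse {q : ℤ} (hq : 0 ≤ q) (a b : ℤ) :
    collapse q (impZ a b) = impZ (collapse q a) (collapse q b) := by
  unfold collapse impZ
  split_ifs <;> omega

/-- The analogue of `tZ_le_impZ` with threshold `-q`: cutting the chain at `-q ≤ 0` amounts to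
collapsing `[-q, q]`. -/
theorem collapse_le_collapse_iff {q : ℤ} (hq : 0 ≤ q) {a b : ℤ} :
    collapse q a ≤ collapse q b ↔ -q ≤ impZ a b := by
  unfold collapse impZ
  split_ifs <;> omega

section Valuations

variable {A B : Bundled.{w} langSM.Structure} {k : ℕ}

theorem IsVal.collapse {f : A → ℤ} (hf : IsVal k f) {j : ℕ} {q : ℤ} (hq : 0 ≤ q)
    (ht : collapse q (tZ k) = tZ j) (hm : ∀ a ∈ Zsub k, collapse q a ∈ Zsub j) :
    IsVal j fun a => Sugihara.collapse q (f a) where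
  mem a := hm _ (hf.mem a)
  map_inf a b := by rw [hf.map_inf]; unfold Sugihara.collapse; omega
  map_sup a b := by rw [hf.map_sup]; unfold Sugihara.collapse; omega
  map_imp a b := by rw [hf.map_imp, impZ_collapse hq]
  map_neg a := by rw [hf.map_neg]; unfold Sugihara.collapse; omega
  map_tt := by rw [hf.map_tt, ht]

/-! ### Homomorphic images of subalgebras of powers of `W_k` -/

/-- Since `a · ((a → b) ∧ t) ≤ b` in `B`, replacing `(a → b) ∧ t` by `t` under `h` gives `h a = h (a
· t) ≤ h b`. -/
theorem sup_eq_of_inf_imp_tt (hB : SeparatedByVal k B) (h : B →[langSM] A) {a b : B}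
    (hab : h (inf B (imp B a b) (tt B)) = tt A) : h (sup B a b) = h b := by
  have h1 : sup B (fusion B a (inf B (imp B a b) (tt B))) b = b := hB _ _ fun f hf => by
    rw [hf.map_sup, hf.map_fusion, hf.map_inf, hf.map_imp, hf.map_tt]
    exact max_eq_right (fusion_imp_le (hf.mem a) (hf.mem b))
  have h2 : fusion B a (tt B) = a := hB _ _ fun f hf => by
    rw [hf.map_fusion, hf.map_tt]
    exact (fusion_tZ (hf.mem a)).1
  calc h (sup B a b) = h (sup B (fusion B a (tt B)) b) := by rw [h2]
    _ = h (sup B (fusion B a (inf B (imp B a b) (tt B))) b) := by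
      rw [hom_sup, hom_sup, hom_fusion, hom_fusion, hab, hom_tt]
    _ = h b := by rw [h1]

theorem eq_of_inf_imp_tt (hB : SeparatedByVal k B) (h : B →[langSM] A) {a b : B}
    (hab : h (inf B (imp B a b) (tt B)) = tt A) (hba : h (inf B (imp B b a) (tt B)) = tt A) :
    h a = h b := by
  rw [← sup_eq_of_inf_imp_tt hB h hab, ← sup_eq_of_inf_imp_tt hB h hba]
  exact congrArg h (hB _ _ fun f hf => by rw [hf.map_sup, hf.map_sup, max_comm])

theorem inf_imp_tt_of_eq (hB : SeparatedByVal k B) (h : B →[langSM] A) {a b : B}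
    (hab : h a = h b) : h (inf B (imp B a b) (tt B)) = tt A := by
  have h1 : inf B (imp B b b) (tt B) = tt B := hB _ _ fun f hf => by
    rw [hf.map_inf, hf.map_imp, hf.map_tt]
    exact min_eq_right ((tZ_le_impZ (hf.mem b) (hf.mem b)).2 le_rfl)
  rw [hom_inf, hom_imp, hab, ← hom_imp, ← hom_inf, h1, hom_tt]

/-- The distributive lattice structure of an algebra whose points are separated by valuations. -/
@[reducible]
def latticeOfSeparated (hB : SeparatedByVal k B) : DistribLattice B :=
  letI : Max B := ⟨sup B⟩
  letI : Min B := ⟨inf B⟩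
  let ev : B → {f : B → ℤ // IsVal k f} → ℤ := fun x f => f.1 x
  letI : LE B := ⟨fun x y => ev x ≤ ev y⟩
  letI : LT B := ⟨fun x y => ev x < ev y⟩
  Function.Injective.distribLattice ev
    (fun x y hxy => hB x y fun f hf => congrFun hxy ⟨f, hf⟩) Iff.rfl Iff.rfl
    (fun _ _ => funext fun f => f.2.map_sup _ _) (fun _ _ => funext fun f => f.2.map_inf _ _)

/-- The elements `x` with `h (x ∧ t) = t` form a filter avoiding `c`, so the prime ideal theorem for
distributive lattices separates it from the ideal generated by `c`. -/
theorem exists_prime_ideal (hB : SeparatedByVal k B) (h : B →[langSM] A) {c : B}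
    (hc : h (inf B c (tt B)) ≠ tt A) :
    ∃ J : Set B, c ∈ J ∧ (∀ x ∈ J, ∀ y ∈ J, sup B x y ∈ J) ∧
      (∀ x, ∀ y ∈ J, (∀ f : B → ℤ, IsVal k f → f x ≤ f y) → x ∈ J) ∧
      (∀ x y, inf B x y ∈ J → x ∈ J ∨ y ∈ J) ∧ ∀ x ∈ J, h (inf B x (tt B)) ≠ tt A := by
  let _ := latticeOfSeparated hB
  have key : ∀ x y : B, x ≤ y → h (x ⊓ tt B) = tt A → h (y ⊓ tt B) = tt A := by
    intro x y hxy hx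
    have h1 : (x ⊓ tt B) ⊓ (y ⊓ tt B) = x ⊓ tt B :=
      inf_eq_left.2 (inf_le_inf_right _ hxy)
    have h2 : tt B ⊓ (y ⊓ tt B) = y ⊓ tt B := inf_eq_right.2 inf_le_right
    calc h (y ⊓ tt B) = h (tt B ⊓ (y ⊓ tt B)) := by rw [h2]
      _ = inf A (h (tt B)) (h (y ⊓ tt B)) := hom_inf h _ _
      _ = inf A (h (x ⊓ tt B)) (h (y ⊓ tt B)) := by rw [hom_tt, hx]
      _ = h ((x ⊓ tt B) ⊓ (y ⊓ tt B)) := (hom_inf h _ _).symm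
      _ = tt A := by rw [h1, hx]
  have hF : Order.IsPFilter {x : B | h (x ⊓ tt B) = tt A} := by
    refine .of_def ⟨tt B, ?_⟩ ?_ fun {x y} hxy hx => key x y hxy hx
    · change h (tt B ⊓ tt B) = tt A
      rw [inf_idem, hom_tt]
    · intro x hx y hy
      refine ⟨x ⊓ y, ?_, inf_le_left, inf_le_right⟩
      change h (x ⊓ y ⊓ tt B) = tt A
      rw [inf_inf_distrib_right]
      refine (hom_inf h _ _).trans ?_
      rw [hx, hy, ← hom_tt h, ← hom_inf]
      exact congrArg h (inf_idem _)
  obtain ⟨J, hJ, hcJ, hd⟩ := DistribLattice.prime_ideal_of_disjoint_filter_ideal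
    (F := hF.toPFilter) (I := Order.Ideal.principal c) (by
      rw [Set.disjoint_left]
      intro x hx hxc
      exact hc (key x c hxc hx))
  refine ⟨J, hcJ (Order.Ideal.mem_principal.2 le_rfl), fun x hx y hy => J.sup_mem hx hy,
    fun x y hy hxy => J.lower (fun f => hxy f.1 f.2) hy, fun x y => hJ.mem_or_mem, ?_⟩
  intro x hx hx'
  exact Set.disjoint_left.1 hd hx' hx

/-- An ultrafilter limit of valuations. -/
theorem exists_limit_valuation (J : Set B) (hne : J.Nonempty)
    (hsup : ∀ x ∈ J, ∀ y ∈ J, sup B x y ∈ J)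
    (hJ : ∀ x ∈ J, ∃ f : B → ℤ, IsVal k f ∧ f x < tZ k) :
    ∃ e : B → ℤ, IsVal k e ∧ ∀ x ∈ J, e x < tZ k := by
  have : Nonempty J := hne.to_subtype
  -- The sets `{f | f x < t}` for `x ∈ J` are nonempty, and directed because `J` is closed under
  -- joins.
  have hbot : (⨅ x : J, Filter.principal {f : {f : B → ℤ // IsVal k f} | f.1 x < tZ k}).NeBot := by
    refine Filter.iInf_neBot_of_directed' ?_ ?_
    · rintro ⟨x, hx⟩ ⟨y, hy⟩
      refine ⟨⟨sup B x y, hsup x hx y hy⟩, ?_, ?_⟩ <;>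
      · refine Filter.principal_mono.2 fun f (hf : f.1 (sup B x y) < tZ k) => ?_
        rw [f.2.map_sup, max_lt_iff] at hf
        first | exact hf.1 | exact hf.2
    · rintro ⟨x, hx⟩
      obtain ⟨f, hf, hfx⟩ := hJ x hx
      exact Filter.principal_neBot_iff.2 ⟨⟨f, hf⟩, hfx⟩
  let U := Ultrafilter.of (⨅ x : J, Filter.principal
    {f : {f : B → ℤ // IsVal k f} | f.1 x < tZ k})
  have hU : ∀ x ∈ J, ∀ᶠ f in (U : Filter {f : B → ℤ // IsVal k f}), f.1 x < tZ k := fun x hx =>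
    ((Ultrafilter.of_le _).trans (iInf_le _ (⟨x, hx⟩ : J))) (Filter.mem_principal_self _)
  -- Valuations in `W k` take finitely many values, so the ultrafilter selects one value at each
  -- point.
  have hlim : ∀ x : B, ∃ a : ℤ, ∀ᶠ f in (U : Filter {f : B → ℤ // IsVal k f}), f.1 x = a := by
    intro x
    obtain ⟨a, -, ha⟩ := (Ultrafilter.eventually_exists_mem_iff (f := U)
      (P := fun a (f : {f : B → ℤ // IsVal k f}) => f.1 x = a)
      (Set.finite_Icc (-((k / 2 : ℕ) : ℤ)) ((k / 2 : ℕ) : ℤ))).1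
      (Filter.Eventually.of_forall fun f =>
        ⟨f.1 x, ⟨(f.2.mem x).1, (f.2.mem x).2.1⟩, rfl⟩)
    exact ⟨a, ha⟩
  choose e he using hlim
  refine ⟨e, ⟨?_, ?_, ?_, ?_, ?_, ?_⟩, ?_⟩
  · intro a
    obtain ⟨f, hf⟩ := (he a).exists
    exact hf ▸ f.2.mem a
  · intro a b
    obtain ⟨f, ⟨h1, h2⟩, h3⟩ := (((he a).and (he b)).and (he (inf B a b))).exists
    rw [← h1, ← h2, ← h3, f.2.map_inf]
  · intro a b
    obtain ⟨f, ⟨h1, h2⟩, h3⟩ := (((he a).and (he b)).and (he (sup B a b))).exists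
    rw [← h1, ← h2, ← h3, f.2.map_sup]
  · intro a b
    obtain ⟨f, ⟨h1, h2⟩, h3⟩ := (((he a).and (he b)).and (he (imp B a b))).exists
    rw [← h1, ← h2, ← h3, f.2.map_imp]
  · intro a
    obtain ⟨f, h1, h2⟩ := ((he a).and (he (neg B a))).exists
    rw [← h1, ← h2, f.2.map_neg]
  · obtain ⟨f, h1⟩ := (he (tt B)).exists
    rw [← h1, f.2.map_tt]
  · intro x hx
    obtain ⟨f, h1, h2⟩ := ((he x).and (hU x hx)).exists
    exact h1 ▸ h2

theorem exists_limit_valuation_with_cut (hB : SeparatedByVal k B) (h : B →[langSM] A) {a b : B}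
    (hab : h (inf B (imp B a b) (tt B)) ≠ tt A) :
    ∃ e : B → ℤ, ∃ s : ℤ, IsVal k e ∧ s ∈ Zsub k ∧ s ≤ tZ k ∧ impZ (e a) (e b) < s ∧
      ∀ x y, h x = h y → s ≤ impZ (e x) (e y) := by
  obtain ⟨J, hcJ, hsup, hlow, hprime, hN⟩ := exists_prime_ideal hB h hab
  have htJ : ∀ y, (∀ f : B → ℤ, IsVal k f → tZ k ≤ f y) → y ∉ J := by
    intro y hy hyJ
    refine hN y hyJ ?_
    have : inf B y (tt B) = tt B := hB _ _ fun f hf => by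
      rw [hf.map_inf, hf.map_tt]
      exact min_eq_right (hy f hf)
    rw [this, hom_tt]
  -- An `x` with `t ≤ f x` for every valuation `f` satisfies `x ∧ t = t`, so it cannot lie in `J`.
  obtain ⟨e, he, heJ⟩ := exists_limit_valuation J ⟨_, hcJ⟩ hsup (k := k) fun x hx => by
    by_contra! hcon
    exact htJ x hcon hx
  have httJ : tt B ∉ J := htJ _ fun f hf => hf.map_tt.ge
  -- The cut `s` is the least value of `e` on the prime filter `Jᶜ`, attained at `g`.
  obtain ⟨g, hg, hgmin⟩ := Set.exists_min_image (e '' Jᶜ) id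
    ((Set.finite_Icc (-((k / 2 : ℕ) : ℤ)) ((k / 2 : ℕ) : ℤ)).subset (by
      rintro _ ⟨x, -, rfl⟩
      exact ⟨(he.mem x).1, (he.mem x).2.1⟩)) ⟨_, tt B, httJ, rfl⟩
  obtain ⟨g, hgJ, rfl⟩ := hg
  refine ⟨e, e g, he, he.mem g, ?_, ?_, ?_⟩
  · rw [← he.map_tt]
    exact hgmin _ ⟨_, httJ, rfl⟩
  · by_contra! hcon
    have h1 : imp B g (imp B a b) ∉ J := fun hJ' => by
      have h2 := heJ _ hJ'
      rw [he.map_imp] at h2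
      refine h2.not_ge ((tZ_le_impZ (he.mem _) (he.mem _)).2 ?_)
      rwa [he.map_imp]
    -- The inequality `g ∧ (g → c) ≤ c` holds in `Z`. With `c = a → b` in the prime ideal `J`, it
    -- forces `g` or `g → c` into `J`.
    have h3 : inf B g (imp B g (imp B a b)) ∈ J := hlow _ _ hcJ fun f hf => by
      rw [hf.map_inf, hf.map_imp g]
      unfold impZ
      split_ifs <;> omega
    exact (hprime _ _ h3).elim hgJ h1
  · intro x y hxy
    rw [← he.map_imp]
    exact hgmin _ ⟨_, fun hJ' => hN _ hJ' (inf_imp_tt_of_eq hB h hxy), rfl⟩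

/-- Points of a homomorphic image of `B` are separated by valuations in `W_k` or `W_{k-1}`. -/
theorem exists_valuation_factoring (hB : SeparatedByVal k B) (h : B →[langSM] A) {a b : B}
    (hab : h a ≠ h b) : ∃ φ : B → ℤ, φ a ≠ φ b ∧ (∀ x y, h x = h y → φ x = φ y) ∧
      (IsVal k φ ∨ Even k ∧ IsVal (k - 1) φ) := by
  wlog hN : h (inf B (imp B a b) (tt B)) ≠ tt A generalizing a b
  · have hN' : h (inf B (imp B b a) (tt B)) ≠ tt A := fun h2 =>
      hab (eq_of_inf_imp_tt hB h (not_not.1 hN) h2)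
    obtain ⟨φ, h1, h2, h3⟩ := this hab.symm hN'
    exact ⟨φ, h1.symm, h2, h3⟩
  obtain ⟨e, s, he, hs, hst, hlt, hle⟩ := exists_limit_valuation_with_cut hB h hN
  rw [mem_Zsub] at hs
  by_cases hk : Even k ∧ s = 1
  · obtain ⟨hk, rfl⟩ := hk
    have htk : tZ k = 1 := if_pos hk
    refine ⟨e, fun hab => ?_, fun x y hxy => le_antisymm ?_ ?_, .inl he⟩
    · rw [← htk, ← not_le, tZ_le_impZ (he.mem _) (he.mem _)] at hlt
      exact hlt hab.le
    · have := hle x y hxy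
      rwa [← htk, tZ_le_impZ (he.mem _) (he.mem _)] at this
    · have := hle y x hxy.symm
      rwa [← htk, tZ_le_impZ (he.mem _) (he.mem _)] at this
  -- For even `k`, `s ≤ t = 1` with `s` neither `0` nor `1`; for odd `k`, `t = 0`. Either way `s ≤
  -- 0`.
  · have hs0 : 0 ≤ -s := by unfold tZ at hst; split_ifs at hst <;> grind
    refine ⟨fun x => collapse (-s) (e x), fun hab => ?_, fun x y hxy => le_antisymm ?_ ?_, ?_⟩
    · have := (collapse_le_collapse_iff hs0).1 hab.le
      omega
    · exact (collapse_le_collapse_iff hs0).2 (by simpa using hle x y hxy)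
    · exact (collapse_le_collapse_iff hs0).2 (by simpa using hle y x hxy.symm)
    -- For even `k`, `s ≤ -1`, so the collapse kills `t = 1` and shortens the chain by at least one
    -- on each side.
    · by_cases hk' : Even k
      · have hs' := hs.2.2 hk'
        have hodd : ¬ Even (k - 1) := by rw [Nat.even_iff] at *; omega
        refine .inr ⟨hk', he.collapse (by omega) ?_ fun a ha => ?_⟩
        · rw [tZ, tZ, if_pos hk', if_neg hodd]
          unfold collapse
          omega
        · rw [mem_Zsub] at ha ⊢
          refine ⟨?_, ?_, fun h => absurd h hodd⟩ <;>
          · unfold collapse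
            rw [Nat.even_iff] at hk'
            omega
      · refine .inl (he.collapse (by omega) ?_ fun a ha => ?_)
        · rw [tZ, if_neg hk']
          unfold collapse
          omega
        · rw [mem_Zsub] at ha ⊢
          refine ⟨?_, ?_, fun h => absurd h hk'⟩ <;>
          · unfold collapse
            omega

theorem exists_valuation_of_mem_HSP {hk : 1 ≤ k} (hA : A ∈ HSP {W.{w} k hk}) {a b : A}
    (hab : a ≠ b) : ∃ φ : A → ℤ, φ a ≠ φ b ∧ (IsVal k φ ∨ Even k ∧ IsVal (k - 1) φ) := by
  obtain ⟨B, hB, h, hh⟩ := hA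
  obtain ⟨a, rfl⟩ := hh a
  obtain ⟨b, rfl⟩ := hh b
  obtain ⟨φ, hφ, hfac, hval⟩ := exists_valuation_factoring
    (separatedByVal_of_mem_ISP (opSP_subset_ISP _ hB)) h hab
  -- As `φ` is constant on the fibres of `h`, composing it with any section of `h` descends it to
  -- `A`.
  have hinv : ∀ x, φ (Function.surjInv hh (h x)) = φ x := fun x =>
    hfac _ _ (Function.surjInv_eq hh _)
  have hdesc : ∀ j, IsVal j φ → IsVal j (φ ∘ Function.surjInv hh) := by
    intro j hj
    refine ⟨fun x => hj.mem _, ?_, ?_, ?_, ?_, ?_⟩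
    · intro x y
      obtain ⟨x, rfl⟩ := hh x
      obtain ⟨y, rfl⟩ := hh y
      rw [← hom_inf]
      simp only [Function.comp, hinv, hj.map_inf]
    · intro x y
      obtain ⟨x, rfl⟩ := hh x
      obtain ⟨y, rfl⟩ := hh y
      rw [← hom_sup]
      simp only [Function.comp, hinv, hj.map_sup]
    · intro x y
      obtain ⟨x, rfl⟩ := hh x
      obtain ⟨y, rfl⟩ := hh y
      rw [← hom_imp]
      simp only [Function.comp, hinv, hj.map_imp]
    · intro x
      obtain ⟨x, rfl⟩ := hh x
      rw [← hom_neg]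
      simp only [Function.comp, hinv, hj.map_neg]
    · rw [← hom_tt h]
      simp only [Function.comp, hinv, hj.map_tt]
  refine ⟨φ ∘ Function.surjInv hh, ?_, hval.imp (hdesc k) fun h => ⟨h.1, hdesc _ h.2⟩⟩
  simpa only [Function.comp, hinv] using hφ

end Valuations

/-! ### From separating valuations to equalities of classes -/

section Varieties

variable {A B : Bundled.{w} langSM.Structure} {k l : ℕ}

theorem HSP_W_subset_ISP_pair (hk : 1 ≤ k) (hk' : 1 ≤ k - 1) :
    HSP {W.{w} k hk} ⊆ ISP {W.{w} k hk, W.{w} (k - 1) hk'} := by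
  intro A hA
  refine mem_ISP_of_separatedBy fun a b hab => ?_
  obtain ⟨φ, hφ, hv | ⟨-, hv⟩⟩ := exists_valuation_of_mem_HSP hA hab
  · exact ⟨_, .inl rfl, hv.toHom hk, hv.toHom_ne hk hφ⟩
  · exact ⟨_, .inr rfl, hv.toHom hk', hv.toHom_ne hk' hφ⟩

theorem ISP_W_eq_HSP_W_of_odd (hk : 1 ≤ k) (hodd : ¬ Even k) :
    ISP {W.{w} k hk} = HSP {W.{w} k hk} := by
  refine (ISP_subset_HSP _).antisymm fun A hA => ?_
  refine mem_ISP_of_separatedBy fun a b hab => ?_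
  obtain ⟨φ, hφ, hv | ⟨h, -⟩⟩ := exists_valuation_of_mem_HSP hA hab
  · exact ⟨_, rfl, hv.toHom hk, hv.toHom_ne hk hφ⟩
  · exact absurd h hodd

/-! ### Comparison of the classes generated by the algebras `W_k` -/

theorem W_mem_ISP (hk : 1 ≤ k) : W.{w} k hk ∈ ISP {W.{w} k hk} :=
  subset_ISP rfl

theorem ISP_W_subset_of_le_of_parity (hk : 1 ≤ k) (hl : 1 ≤ l) (hkl : k ≤ l)
    (hpar : Even k ↔ Even l) : ISP {W.{w} k hk} ⊆ ISP {W.{w} l hl} := by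
  refine ISP_subset_ISP ?_
  rintro _ rfl a b hab
  have hv : IsVal l (valW.{w} hk) := by
    refine { isVal_valW hk with mem := fun a => ?_, map_tt := ?_ }
    · obtain ⟨h1, h2, h3⟩ := (isVal_valW hk).mem a
      rw [mem_Zsub]
      exact ⟨by omega, by omega, fun h => h3 (hpar.2 h)⟩
    · rw [(isVal_valW hk).map_tt, tZ, tZ]
      simp only [hpar]
  exact ⟨_, rfl, hv.toHom hl, hv.toHom_ne hl fun h => hab (valW_injective hk h)⟩

theorem ISP_W_one_subset (K : Set (Bundled.{w} langSM.Structure)) :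
    ISP {W.{w} 1 le_rfl} ⊆ ISP K := by
  refine ISP_subset_ISP ?_
  rintro _ rfl a b hab
  refine absurd (valW_injective _ ?_) hab
  have ha := (isVal_valW le_rfl).mem a
  have hb := (isVal_valW le_rfl).mem b
  rw [mem_Zsub] at ha hb
  omega

theorem W_mem_opH_of_odd_of_even (hk : 1 ≤ k) (hl : 1 ≤ l) (hkl : k ≤ l) (hodd : ¬ Even k)
    (heven : Even l) : W.{w} k hk ∈ opH {W.{w} l hl} := by
  have hodd' := hodd
  have heven' := heven
  rw [Nat.even_iff] at hodd' heven'
  -- The width `l / 2 - k / 2` takes the top of `W l` to the top of `W k`; it is positive by parity,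
  -- so `t = 1` goes to `0`.
  have hv := (isVal_valW.{w} hl).collapse (j := k) (q := ((l / 2 - k / 2 : ℕ) : ℤ)) (by omega) (by
    rw [tZ, tZ, if_pos heven, if_neg hodd]
    unfold collapse
    omega) (fun a ha => by
    rw [mem_Zsub] at ha ⊢
    refine ⟨?_, ?_, fun h => absurd h hodd⟩ <;>
    · unfold collapse
      omega)
  refine ⟨_, rfl, hv.toHom hk, fun y => ?_⟩
  have hy := (isVal_valW hk).mem y
  rw [mem_Zsub] at hy
  have hex : ∃ a ∈ Zsub l, collapse ((l / 2 - k / 2 : ℕ) : ℤ) a = valW hk y := by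
    unfold collapse
    rcases le_or_gt 0 (valW hk y) with h | h
    · refine ⟨valW hk y + ((l / 2 - k / 2 : ℕ) : ℤ), ?_, by omega⟩
      rw [mem_Zsub]
      exact ⟨by omega, by omega, fun _ => by omega⟩
    · refine ⟨valW hk y - ((l / 2 - k / 2 : ℕ) : ℤ), ?_, by omega⟩
      rw [mem_Zsub]
      exact ⟨by omega, by omega, fun _ => by omega⟩
  obtain ⟨a, ha, hay⟩ := hex
  exact ⟨mkW hl a ha, valW_injective hk hay⟩

/-! ### Obstructions to valuations between the chains -/

theorem zero_mem_Zsub (hodd : ¬ Even k) : (0 : ℤ) ∈ Zsub k := by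
  rw [mem_Zsub]
  exact ⟨by omega, by omega, fun h => absurd h hodd⟩

theorem IsVal.apply_zero {hk : 1 ≤ k} {f : W.{w} k hk → ℤ} (hf : IsVal l f)
    (h0 : (0 : ℤ) ∈ Zsub k) : f (mkW hk 0 h0) = 0 := by
  have h := hf.map_neg (mkW hk 0 h0)
  have h1 : neg _ (mkW.{w} hk 0 h0) = mkW hk 0 h0 := valW_injective hk (by
    rw [(isVal_valW hk).map_neg]; rfl)
  rw [h1] at h
  omega

theorem not_isVal_of_odd_of_even {hk : 1 ≤ k} (hodd : ¬ Even k) (heven : Even l)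
    (f : W.{w} k hk → ℤ) : ¬ IsVal l f := fun hf =>
  (hf.mem _).2.2 heven (hf.apply_zero (zero_mem_Zsub hodd))

theorem one_mem_Zsub (hk : 2 ≤ k) : (1 : ℤ) ∈ Zsub k := by
  rw [mem_Zsub]
  exact ⟨by omega, by omega, fun _ => one_ne_zero⟩

theorem W_notMem_ISP_of_odd_of_even (hk : 1 ≤ k) (hk2 : 2 ≤ k) (hl : 1 ≤ l) (hodd : ¬ Even k)
    (heven : Even l) : W.{w} k hk ∉ ISP {W.{w} l hl} := by
  intro h
  refine zero_ne_one (α := ℤ) (congrArg (valW.{w} hk) (separatedByVal_of_mem_ISP h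
    (mkW hk 0 (zero_mem_Zsub hodd)) (mkW hk 1 (one_mem_Zsub hk2)) fun f hf => ?_))
  exact absurd hf (not_isVal_of_odd_of_even hodd heven f)

theorem neg_tZ_mem (k : ℕ) (hk : 1 ≤ k) : -tZ k ∈ Zsub k := by
  have h := tZ_mem k hk
  rw [mem_Zsub] at h ⊢
  exact ⟨by omega, by omega, fun hk => neg_ne_zero.2 (h.2.2 hk)⟩

theorem IsVal.monotone {hk : 1 ≤ k} {f : W.{w} k hk → ℤ} (hf : IsVal l f) {a b : ℤ}
    (ha : a ∈ Zsub k) (hb : b ∈ Zsub k) (hab : a ≤ b) : f (mkW hk a ha) ≤ f (mkW hk b hb) := by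
  have h : sup _ (mkW.{w} hk a ha) (mkW hk b hb) = mkW hk b hb := valW_injective hk (by
    rw [(isVal_valW hk).map_sup]
    exact max_eq_right hab)
  rw [← h, hf.map_sup]
  exact le_max_left _ _

/-- A valuation of `W_k` separating `1` from its lower neighbour is injective. -/
theorem IsVal.strictMono {hk : 1 ≤ k} (hk2 : 2 ≤ k) {f : W.{w} k hk → ℤ} (hf : IsVal l f)
    (hne : f (mkW hk 1 (one_mem_Zsub hk2)) ≠ f (mkW hk (-tZ k) (neg_tZ_mem k hk))) {a b : ℤ}
    (ha : a ∈ Zsub k) (hb : b ∈ Zsub k) (ha0 : 0 < a) (hab : a < b) :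
    f (mkW hk a ha) < f (mkW hk b hb) := by
  refine (hf.monotone ha hb hab.le).lt_of_ne fun heq => hne ?_
  have hnb : -b ∈ Zsub k := by
    rw [mem_Zsub] at hb ⊢
    exact ⟨by omega, by omega, fun _ => by omega⟩
  -- For `0 < a < b`, `b → a = -b` while `a → b = b`. Identifying `a` with `b` thus identifies `-b`
  -- with `b`, and by monotonicity everything between, including `-t` and `1`.
  have himp : imp _ (mkW.{w} hk b hb) (mkW hk a ha) = mkW hk (-b) hnb := valW_injective hk (by
    rw [(isVal_valW hk).map_imp]
    simp only [valW_mkW]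
    unfold impZ
    split_ifs <;> omega)
  have himp' : imp _ (mkW.{w} hk a ha) (mkW hk b hb) = mkW hk b hb := valW_injective hk (by
    rw [(isVal_valW hk).map_imp]
    simp only [valW_mkW]
    unfold impZ
    split_ifs <;> omega)
  have h1 : f (mkW hk (-b) hnb) = f (mkW hk b hb) := by
    have e1 := hf.map_imp (mkW hk b hb) (mkW hk a ha)
    have e2 := hf.map_imp (mkW hk a ha) (mkW hk b hb)
    rw [himp, heq] at e1
    rw [himp', heq] at e2
    exact e1.trans e2.symm
  have ht : tZ k = 0 ∨ tZ k = 1 := by unfold tZ; split_ifs <;> simp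
  have h2 := hf.monotone (one_mem_Zsub hk2) hb (by omega)
  have h3 := hf.monotone hnb (neg_tZ_mem k hk) (by omega)
  have h4 := hf.monotone (neg_tZ_mem k hk) (one_mem_Zsub hk2) (by omega)
  omega

/-- The value at `1` is at least `1` and strict monotonicity adds at least one per step, so `k / 2 ≤
l / 2`. -/
theorem le_of_isVal {hk : 1 ≤ k} (hk2 : 2 ≤ k) {f : W.{w} k hk → ℤ} (hf : IsVal l f)
    (hne : f (mkW hk 1 (one_mem_Zsub hk2)) ≠ f (mkW hk (-tZ k) (neg_tZ_mem k hk))) : k ≤ l := by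
  have hmem : ∀ n : ℕ, n + 1 ≤ k / 2 → ((n + 1 : ℕ) : ℤ) ∈ Zsub k := fun n hn => by
    rw [mem_Zsub]
    exact ⟨by omega, by omega, fun _ => by omega⟩
  have key : ∀ (n : ℕ) (hn : n + 1 ≤ k / 2), ((n + 1 : ℕ) : ℤ) ≤ f (mkW hk _ (hmem n hn)) := by
    intro n
    induction n with
    | zero =>
      intro hn
      have ht : tZ k = 0 ∨ tZ k = 1 := by unfold tZ; split_ifs <;> simp
      have hm1 : (-1 : ℤ) ∈ Zsub k := by
        rw [mem_Zsub]
        exact ⟨by omega, by omega, fun _ => by omega⟩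
      have h1 := hf.monotone hm1 (neg_tZ_mem k hk) (by omega)
      have h2 := hf.monotone (neg_tZ_mem k hk) (one_mem_Zsub hk2) (by omega)
      have h3 := hf.map_neg (mkW hk 1 (one_mem_Zsub hk2))
      have h4 : neg _ (mkW.{w} hk 1 (one_mem_Zsub hk2)) = mkW hk (-1) hm1 :=
        valW_injective hk (by rw [(isVal_valW hk).map_neg]; rfl)
      rw [h4] at h3
      change (1 : ℤ) ≤ f (mkW hk 1 (one_mem_Zsub hk2))
      omega
    | succ n ih =>
      intro hn
      have h1 := ih (by omega)
      have h2 := hf.strictMono hk2 hne (hmem n (by omega)) (hmem (n + 1) hn) (by omega) (by omega)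
      push_cast at h1 h2 ⊢
      omega
  have h1 := key (k / 2 - 1) (by omega)
  have h2 := (hf.mem (mkW hk _ (hmem (k / 2 - 1) (by omega)))).2.1
  by_cases hodd : Even k
  · rw [Nat.even_iff] at hodd
    omega
  -- Halving loses parity: `l = k - 1` with `k` odd must be excluded separately, by the fixed point
  -- of negation.
  · have hl : ¬ Even l := fun heven => not_isVal_of_odd_of_even hodd heven f hf
    rw [Nat.even_iff] at hodd hl
    omega

theorem W_notMem_HSP_of_lt (hk : 1 ≤ k) (hl : 1 ≤ l) (hlk : l < k) :
    W.{w} k hk ∉ HSP {W.{w} l hl} := by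
  intro h
  have hk2 : 2 ≤ k := by omega
  have ht : tZ k = 0 ∨ tZ k = 1 := by unfold tZ; split_ifs <;> simp
  obtain ⟨φ, hφ, hv | ⟨-, hv⟩⟩ := exists_valuation_of_mem_HSP h
    (a := mkW hk 1 (one_mem_Zsub hk2)) (b := mkW hk (-tZ k) (neg_tZ_mem k hk)) (fun h => by
      have := congrArg (valW hk) h
      simp only [valW_mkW] at this
      omega)
  · have := le_of_isVal hk2 hv hφ
    omega
  · have := le_of_isVal hk2 hv hφ
    omega

/-- Valuations in an odd chain send both `t` and `¬t` to `0`, whereas `t ≠ ¬t` in an even chain. -/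
theorem W_notMem_HSP_of_even_of_odd (hk : 1 ≤ k) (hl : 1 ≤ l) (heven : Even k) (hodd : ¬ Even l) :
    W.{w} k hk ∉ HSP {W.{w} l hl} := by
  intro h
  have hk2 : 2 ≤ k := by rw [Nat.even_iff] at heven; omega
  have ht : tZ k = 1 := if_pos heven
  have htt : tt (W.{w} k hk) = mkW hk 1 (one_mem_Zsub hk2) := valW_injective hk (by
    rw [(isVal_valW hk).map_tt, ht]; rfl)
  obtain ⟨φ, hφ, hv | ⟨h, -⟩⟩ := exists_valuation_of_mem_HSP h
    (a := tt (W.{w} k hk)) (b := neg _ (tt (W.{w} k hk))) (fun h => by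
      have := congrArg (valW hk) h
      rw [(isVal_valW hk).map_neg, (isVal_valW hk).map_tt] at this
      omega)
  · refine hφ ?_
    rw [hv.map_neg, hv.map_tt, tZ, if_neg hodd, neg_zero]
  · exact hodd h

/-! ### Inclusion criteria and strictness -/

theorem HSP_W_subset_iff (hk : 1 ≤ k) (hl : 1 ≤ l) :
    HSP {W.{w} k hk} ⊆ HSP {W.{w} l hl} ↔ k ≤ l ∧ (Even k → Even l) := by
  constructor
  · intro h
    have hmem := h (ISP_subset_HSP _ (W_mem_ISP hk))
    refine ⟨?_, fun heven => ?_⟩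
    · by_contra! hlt
      exact W_notMem_HSP_of_lt hk hl hlt hmem
    · by_contra hodd
      exact W_notMem_HSP_of_even_of_odd hk hl heven hodd hmem
  · rintro ⟨hkl, hpar⟩
    refine HSP_subset_HSP ?_
    by_cases h : Even l → Even k
    · exact (ISP_W_subset_of_le_of_parity hk hl hkl ⟨hpar, h⟩).trans (ISP_subset_HSP _)
    · push Not at h
      refine ISP_subset_HSP_of_subset_opH ?_
      rintro _ rfl
      exact W_mem_opH_of_odd_of_even hk hl hkl h.2 h.1

theorem ISP_W_subset_iff (hk : 1 ≤ k) (hl : 1 ≤ l) :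
    ISP {W.{w} k hk} ⊆ ISP {W.{w} l hl} ↔ k = 1 ∨ (k ≤ l ∧ (Even k ↔ Even l)) := by
  constructor
  · intro h
    have hmem := h (W_mem_ISP hk)
    obtain ⟨hkl, hpar⟩ := (HSP_W_subset_iff hk hl).1
      (HSP_subset_HSP (h.trans (ISP_subset_HSP _)))
    by_cases hk1 : k = 1
    · exact .inl hk1
    · refine .inr ⟨hkl, hpar, fun heven => ?_⟩
      by_contra hodd
      exact W_notMem_ISP_of_odd_of_even hk (by omega) hl hodd heven hmem
  · rintro (rfl | ⟨hkl, hpar⟩)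
    · exact ISP_W_one_subset _
    · exact ISP_W_subset_of_le_of_parity hk hl hkl hpar

theorem HSP_W_subset_SM (hk : 1 ≤ k) : HSP {W.{w} k hk} ⊆ SM := by
  rintro A ⟨B, hB, h, hh⟩
  have hsep := separatedByVal_of_mem_ISP (opSP_subset_ISP _ hB)
  refine ⟨opH_trans (B := reductSA B) (ISP_subset_HSP _ ?_) (reductHom h) hh, fun a => ?_⟩
  · have : Nonempty (reductSA B) := ⟨tt B⟩
    refine mem_ISP_of_separatedBy fun a b hab => ?_
    by_contra! hcon
    exact hab (hsep a b fun f hf => congrArg ULift.down (hcon _ rfl hf.toHomZ))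
  · obtain ⟨x, rfl⟩ := hh a
    rw [← hom_tt h, ← hom_fusion, ← hom_fusion]
    refine ⟨congrArg h (hsep _ _ fun f hf => ?_), congrArg h (hsep _ _ fun f hf => ?_)⟩ <;>
    rw [hf.map_fusion, hf.map_tt]
    · exact (fusion_tZ (hf.mem x)).2
    · exact (fusion_tZ (hf.mem x)).1

/-- The next chain `W (k + 1)` witnesses strictness. -/
theorem HSP_W_ssubset_SM (hk : 1 ≤ k) : HSP {W.{w} k hk} ⊂ SM :=
  ⟨HSP_W_subset_SM hk, fun h => W_notMem_HSP_of_lt (k := k + 1) (by omega) hk (by omega)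
    (h (HSP_W_subset_SM _ (ISP_subset_HSP _ (W_mem_ISP _))))⟩

theorem W_pred_mem_opH (hk : 1 ≤ k) (hk' : 1 ≤ k - 1) (heven : Even k) :
    W.{w} (k - 1) hk' ∈ opH {W.{w} k hk} := by
  have hodd : ¬ Even (k - 1) := by rw [Nat.even_iff] at *; omega
  exact W_mem_opH_of_odd_of_even hk' hk (by omega) hodd heven

theorem HSP_W_eq_ISP_pair (hk : 1 ≤ k) (hk' : 1 ≤ k - 1) (heven : Even k) :
    HSP {W.{w} k hk} = ISP {W.{w} k hk, W.{w} (k - 1) hk'} := by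
  refine (HSP_W_subset_ISP_pair hk hk').antisymm (ISP_subset_HSP_of_subset_opH ?_)
  rintro _ (rfl | rfl)
  · exact ⟨_, rfl, FirstOrder.Language.Hom.id _ _, Function.surjective_id⟩
  · exact W_pred_mem_opH hk hk' heven

/-- The witness is `W (k - 1)`: a homomorphic image of `W k`, nontrivial since `k ≥ 3`, with no
homomorphism to `W k`. -/
theorem ISP_W_ssubset_HSP_W_of_even (hk : 1 ≤ k) (hk3 : 3 ≤ k) (heven : Even k) :
    ISP {W.{w} k hk} ⊂ HSP {W.{w} k hk} := by
  refine ⟨ISP_subset_HSP _, fun h => ?_⟩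
  have hodd : ¬ Even (k - 1) := by rw [Nat.even_iff] at *; omega
  have hk' : 1 ≤ k - 1 := by omega
  refine W_notMem_ISP_of_odd_of_even hk' (by omega) hk hodd heven (h ?_)
  rw [HSP_W_eq_ISP_pair hk hk' heven]
  exact subset_ISP (.inr rfl)

end Varieties

end Sugihara

theorem proposition3p2 :
    -- (i)
    (∀ (m : ℕ) (hm : 1 ≤ m),
      Sugihara.ISP {Sugihara.W.{w} (2 * m - 1) (by omega)} =
          Sugihara.HSP {Sugihara.W.{w} (2 * m - 1) (by omega)} ∧
        Sugihara.IsVariety (Sugihara.ISP {Sugihara.W.{w} (2 * m - 1) (by omega)})) ∧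
    -- (ii)
    (∀ (m : ℕ) (hm : 2 ≤ m),
      Sugihara.ISP {Sugihara.W.{w} (2 * m) (by omega)} ⊂
        Sugihara.HSP {Sugihara.W.{w} (2 * m) (by omega)}) ∧
    (∀ (m : ℕ) (hm : 1 ≤ m),
      Sugihara.HSP {Sugihara.W.{w} (2 * m) (by omega)} =
        Sugihara.ISP {Sugihara.W.{w} (2 * m) (by omega),
          Sugihara.W.{w} (2 * m - 1) (by omega)}) ∧
    -- (iii)
    (∀ (k l : ℕ) (hk : 1 ≤ k) (hl : 1 ≤ l),
      Sugihara.ISP {Sugihara.W.{w} k hk} ⊆ Sugihara.ISP {Sugihara.W.{w} l hl} ↔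
        k = 1 ∨ (k ≤ l ∧ (Even k ↔ Even l))) ∧
    (∀ (k l : ℕ) (hk : 1 ≤ k) (hl : 1 ≤ l),
      Sugihara.HSP {Sugihara.W.{w} k hk} ⊆ Sugihara.HSP {Sugihara.W.{w} l hl} ↔
        k ≤ l ∧ (Even k → Even l)) ∧
    (∀ (k : ℕ) (hk : 1 ≤ k),
      Sugihara.ISP {Sugihara.W.{w} k hk} ⊂ Sugihara.SM ∧
        Sugihara.HSP {Sugihara.W.{w} k hk} ⊂ Sugihara.SM) ∧
    (∀ (m n : ℕ) (hm : 1 ≤ m) (hn : 1 ≤ n),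
      Sugihara.W.{w} (2 * m) (by omega) ∉
        Sugihara.HSP {Sugihara.W.{w} (2 * n - 1) (by omega)}) ∧
    (∀ (k l : ℕ) (hk : 1 ≤ k) (hl : 1 ≤ l), l < k →
      Sugihara.W.{w} k hk ∉ Sugihara.HSP {Sugihara.W.{w} l hl}) := by
  refine ⟨fun m hm => ?_, fun m hm => ?_, fun m hm => ?_, fun k l hk hl => ?_, fun k l hk hl => ?_,
    fun k hk => ?_, fun m n hm hn => ?_, fun k l hk hl hlk => ?_⟩
  · have h := Sugihara.ISP_W_eq_HSP_W_of_odd.{w} (k := 2 * m - 1) (by omega)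
      (by rw [Nat.even_iff]; omega)
    exact ⟨h, Sugihara.isVariety_ISP h⟩
  · exact Sugihara.ISP_W_ssubset_HSP_W_of_even _ (by omega) (even_two_mul m)
  · exact Sugihara.HSP_W_eq_ISP_pair _ _ (even_two_mul m)
  · exact Sugihara.ISP_W_subset_iff hk hl
  · exact Sugihara.HSP_W_subset_iff hk hl
  · exact ⟨(Sugihara.ISP_subset_HSP _).trans_ssubset (Sugihara.HSP_W_ssubset_SM hk),
      Sugihara.HSP_W_ssubset_SM hk⟩
  · exact Sugihara.W_notMem_HSP_of_even_of_odd _ _ (even_two_mul m)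
      (by rw [Nat.even_iff]; omega)
  · exact Sugihara.W_notMem_HSP_of_lt hk hl hlk
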